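/- Let $X\in\mathbb C^{n\times p}$ and $X_\perp\in\mathbb C^{n\times(n-p)}$ be such that $[X,\,X_\perp]$ is a unitary matrix, and let $Y\in\mathbb C^{n\times p}$ be a matrix of full rank with $\operatorname{rank}(Y)=\operatorname{rank}(X^HY)$. Let $P_{\mathcal X^\perp}$ be the orthogonal projection of $\mathbb C^n$ onto the column range $\mathcal R(X_\perp)$. For subspaces $\mathcal X,\mathcal Y$ of $\mathbb C^n$ and $m=\min(\dim\mathcal X,\dim\mathcal Y)$, the vector of principal angles $\Theta(\mathcal X,\mathcal Y)=[\theta_1,\dots,\theta_m]$, $\theta_k\in[0,\pi/2]$, is defined recursively by $$\cos\theta_k=\max_{x\in\mathcal X}\max_{y\in\mathcal Y}|x^Hy|=|x_k^Hy_k|\quad\text{subject to }\|x\|=\|y\|=1,\ x^Hx_i=0,\ y^Hy_i=0,\ i=1,\dots,k-1.$$ Then $X^HY$ is invertible, the principal angles between $\mathcal R(X)$ and $\mathcal R(Y)$ exist, there are exactly $p$ of them, they all lie in $[0,\pi/2)$, and $$\tan\Theta(\mathcal R(X),\mathcal R(Y))=S\left(P_{\mathcal X^\perp}\,Y\,(X^HY)^{-1}\right),$$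 where $S(A)$ is the vector of all $\min(n,p)=p$ singular values of the $n\times p$ matrix $A$, counted with multiplicity and zeros included, and both vectors are arranged in decreasing order. -/

import Mathlib

open scoped Matrix

/-- The column range `R(A)` of a complex matrix `A`, as a subspace of `ℂⁿ` with its standard
Hermitian inner product. -/
noncomputable def colRange {n p : ℕ} (A : Matrix (Fin n) (Fin p) ℂ) :
    Submodule ℂ (EuclideanSpace ℂ (Fin n)) :=
  LinearMap.range (Matrix.toEuclideanLin A)

/-- The matrix, in the standard basis, of the orthogonal projection of `ℂⁿ` onto `K`. -/
noncomputable def orthProjMatrix {n : ℕ} (K : Submodule ℂ (EuclideanSpace ℂ (Fin n))) :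
    Matrix (Fin n) (Fin n) ℂ :=
  Matrix.toEuclideanLin.symm (K.starProjection : _ →ₗ[ℂ] _)

/-- The vector `S(A)` of the singular values of an `n × p` matrix, in decreasing order and counted
with multiplicity. It has `min n p` entries. -/
noncomputable def singularVector {n p : ℕ} (A : Matrix (Fin n) (Fin p) ℂ) :
    Fin (min n p) → ℝ :=
  fun k => (Matrix.toEuclideanLin A).singularValues k

/-- The pairs `(x, y)` admissible at step `k` of the recursive definition of the principal angles
between `K` and `L`: unit vectors of `K` and `L` that are orthogonal to the principal vectors
`u i`, respectively `v i`, chosen in the steps `i < k`. -/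
def AdmissiblePair {n m : ℕ} (K L : Submodule ℂ (EuclideanSpace ℂ (Fin n)))
    (u v : Fin m → EuclideanSpace ℂ (Fin n)) (k : Fin m) (x y : EuclideanSpace ℂ (Fin n)) : Prop :=
  x ∈ K ∧ y ∈ L ∧ ‖x‖ = 1 ∧ ‖y‖ = 1 ∧ ∀ i < k, inner ℂ x (u i) = 0 ∧ inner ℂ y (v i) = 0

/-- `θ` is the vector `Θ(K, L) = [θ₁, …, θₘ]` of the principal angles between `K` and `L`, where
`m = min (dim K) (dim L)`: there are principal vectors `u k`, `v k` such that, recursively,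
`cos (θ k) = |⟨u k, v k⟩|` is the maximum of `|⟨x, y⟩|` over the pairs admissible at step `k`. -/
def IsPrincipalAngles {n m : ℕ} (K L : Submodule ℂ (EuclideanSpace ℂ (Fin n)))
    (θ : Fin m → ℝ) : Prop :=
  m = min (Module.finrank ℂ K) (Module.finrank ℂ L) ∧
  ∃ u v : Fin m → EuclideanSpace ℂ (Fin n), ∀ k : Fin m,
    θ k ∈ Set.Icc 0 (Real.pi / 2) ∧
    AdmissiblePair K L u v k (u k) (v k) ∧
    Real.cos (θ k) = ‖(inner ℂ (u k) (v k) : ℂ)‖ ∧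
    ∀ x y, AdmissiblePair K L u v k x y →
      ‖(inner ℂ x y : ℂ)‖ ≤ Real.cos (θ k)

/-! Put Z = Y(XᴴY)⁻¹ and T = P_{X⊥}Z. Then R(Z) = R(Y) and XᴴZ = 1, so Z = X + T: R(Y) is a graph
over R(X), and ZᴴZ = 1 + TᴴT. The angle computation uses only the resulting Gram identities for f =
X and g = Z.

Let K = R(f), L = R(g). Greedy maximality alone, for any choice of principal vectors, forces P_L u_k
= ⟨v_k, u_k⟩ v_k and P_K v_k = ⟨u_k, v_k⟩ u_k (`starProjection_principalVectors`). Writing u_k = f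
a_k, this becomes a_k = cos²θ_k (1 + T*T) a_k. So the a_k form an orthonormal eigenbasis of T*T with
eigenvalues tan²θ_k, and any eigenbasis determines the sorted eigenvalues. Conversely, eigenvectors
of T*T, smallest eigenvalue first, produce principal vectors by a Rayleigh bound. -/

section Abstract

variable {V : Type*} [NormedAddCommGroup V] [InnerProductSpace ℂ V]

/-- If a unit vector `v` of `L` pairs with `u` at least as strongly as the normalized projection of
`u` onto `L` does, then the projection of `u` is a multiple of `v`. -/
theorem starProjection_eq_inner_smul_of_le {L : Submodule ℂ V} [L.HasOrthogonalProjection]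
    {u v : V} (hv : v ∈ L) (hv1 : ‖v‖ = 1)
    (h : L.starProjection u ≠ 0 →
      ‖(inner ℂ u (((‖L.starProjection u‖⁻¹ : ℝ) : ℂ) • L.starProjection u) : ℂ)‖ ≤
        ‖(inner ℂ u v : ℂ)‖) :
    L.starProjection u = (inner ℂ v u : ℂ) • v := by
  set q := L.starProjection u with hq
  have hqv : (inner ℂ v q : ℂ) = inner ℂ v u := by
    rw [hq, ← Submodule.inner_starProjection_left_eq_right,
      Submodule.starProjection_eq_self_iff.2 hv]
  have huq : (inner ℂ u q : ℂ) = (‖q‖ : ℂ) ^ 2 := by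
    have : (inner ℂ u q : ℂ) = inner ℂ q q := by
      have hqq : L.starProjection q = q :=
        Submodule.starProjection_eq_self_iff.2 (Submodule.starProjection_apply_mem _ _)
      conv_lhs => rw [← hqq, ← Submodule.inner_starProjection_left_eq_right]
    rw [this, inner_self_eq_norm_sq_to_K]; rfl
  have hle : ‖q‖ ≤ ‖(inner ℂ v q : ℂ)‖ := by
    by_cases h0 : q = 0
    · simp [h0]
    have h1 := h h0
    have hpos : 0 < ‖q‖ := norm_pos_iff.2 h0
    rw [inner_smul_right, huq, norm_inner_symm u v, ← hqv, norm_mul, norm_pow] at h1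
    simp only [Complex.norm_real, norm_inv, norm_norm] at h1
    have : ‖q‖⁻¹ * ‖q‖ ^ 2 = ‖q‖ := by field_simp
    linarith
  -- Equality case of Cauchy–Schwarz: the left side is ‖q‖² - |⟨v, q⟩|².
  have key : ‖q - (inner ℂ v q : ℂ) • v‖ ^ 2 ≤ 0 := by
    rw [@norm_sub_sq ℂ, inner_smul_right, norm_smul, hv1, mul_one, ← inner_conj_symm q v,
      RCLike.mul_conj, ← RCLike.ofReal_pow, RCLike.ofReal_re]
    nlinarith [norm_nonneg q]
  rw [← hqv, ← sub_eq_zero, ← norm_eq_zero]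
  exact pow_eq_zero_iff (two_ne_zero) |>.1 (le_antisymm key (sq_nonneg _))

/-- The sorted eigenvalues of a symmetric operator can be read off from any eigenbasis. -/
theorem LinearMap.IsSymmetric.eigenvalues_eq_of_basis {S : V →ₗ[ℂ] V} [FiniteDimensional ℂ V]
    (hS : S.IsSymmetric) {p : ℕ} (hp : Module.finrank ℂ V = p) (b : Module.Basis (Fin p) ℂ V)
    {μ : Fin p → ℝ} (hμ : Antitone μ) (hb : ∀ i, S (b i) = (μ i : ℂ) • b i) :
    hS.eigenvalues hp = μ := by
  have hmat : S.toMatrix b b = Matrix.diagonal (fun i => (μ i : ℂ)) := by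
    ext i j
    simp only [LinearMap.toMatrix_apply, hb, map_smul, Finsupp.smul_apply,
      Module.Basis.repr_self, Matrix.diagonal_apply, Finsupp.single_apply, smul_eq_mul]
    grind
  have hroots : S.charpoly.roots = Multiset.map (fun i => (μ i : ℂ)) Finset.univ.val := by
    rw [← LinearMap.charpoly_toMatrix _ b, hmat, Matrix.charpoly_diagonal,
      Polynomial.roots_prod _ _ (by
        simp [Finset.prod_ne_zero_iff, Polynomial.X_sub_C_ne_zero])]
    simp
  rw [← List.ofFn_inj, ← hS.sort_roots_charpoly_eq_eigenvalues hp, hroots]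
  simp_rw [Fin.univ_val_map, Multiset.map_coe, List.map_ofFn, Function.comp_def,
    RCLike.re_eq_complex_re, Complex.ofReal_re, Multiset.coe_sort]
  apply List.mergeSort_of_pairwise
  simp_rw [decide_eq_true_eq]
  exact List.sortedGE_iff_pairwise.1 hμ.sortedGE_ofFn

end Abstract

/-! ### Projections of greedily chosen principal vectors -/

section PrincipalVectors

variable {n m : ℕ} {K L : Submodule ℂ (EuclideanSpace ℂ (Fin n))}
  {u v : Fin m → EuclideanSpace ℂ (Fin n)}

theorem AdmissiblePair.mono {j k : Fin m} (hjk : j ≤ k) {x y : EuclideanSpace ℂ (Fin n)}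
    (h : AdmissiblePair K L u v k x y) : AdmissiblePair K L u v j x y :=
  ⟨h.1, h.2.1, h.2.2.1, h.2.2.2.1, fun i hi => h.2.2.2.2 i (hi.trans_le hjk)⟩

/-- Greedily chosen principal vectors are mapped to multiples of each other by the orthogonal
projections onto the two subspaces. -/
theorem starProjection_principalVectors
    (hadm : ∀ k, AdmissiblePair K L u v k (u k) (v k))
    (hmax : ∀ k x y, AdmissiblePair K L u v k x y →
      ‖(inner ℂ x y : ℂ)‖ ≤ ‖(inner ℂ (u k) (v k) : ℂ)‖) (k : Fin m) :
    L.starProjection (u k) = (inner ℂ (v k) (u k) : ℂ) • v k ∧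
      K.starProjection (v k) = (inner ℂ (u k) (v k) : ℂ) • u k := by
  induction k using WellFoundedLT.induction with
  | ind k ih =>
  obtain ⟨huK, hvL, hu1, hv1, horth⟩ := hadm k
  constructor
  · apply starProjection_eq_inner_smul_of_le hvL hv1
    intro h0
    refine hmax k _ _ ⟨huK, L.smul_mem _ (Submodule.starProjection_apply_mem _ _), hu1, ?_,
      fun i hi => ⟨(horth i hi).1, ?_⟩⟩
    · rw [norm_smul, Complex.norm_real, norm_inv, norm_norm,
        inv_mul_cancel₀ (norm_ne_zero_iff.2 h0)]
    · rw [inner_smul_left, Submodule.inner_starProjection_left_eq_right,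
        Submodule.starProjection_eq_self_iff.2 (hadm i).2.1]
      -- It remains that ⟨u k, v i⟩ = 0. Since u k lies in K, v i may be replaced by its projection
      -- to K, which by induction is a multiple of u i.
      rw [← Submodule.starProjection_eq_self_iff.2 huK,
        Submodule.inner_starProjection_left_eq_right, (ih i hi).2, inner_smul_right,
        (horth i hi).1, mul_zero, mul_zero]
  · apply starProjection_eq_inner_smul_of_le huK hu1
    intro h0
    rw [norm_inner_symm, norm_inner_symm (v k)]
    refine hmax k _ _ ⟨K.smul_mem _ (Submodule.starProjection_apply_mem _ _), hvL, ?_, hv1,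
      fun i hi => ⟨?_, (horth i hi).2⟩⟩
    · rw [norm_smul, Complex.norm_real, norm_inv, norm_norm,
        inv_mul_cancel₀ (norm_ne_zero_iff.2 h0)]
    · rw [inner_smul_left, Submodule.inner_starProjection_left_eq_right,
        Submodule.starProjection_eq_self_iff.2 (hadm i).1]
      rw [← Submodule.starProjection_eq_self_iff.2 hvL,
        Submodule.inner_starProjection_left_eq_right, (ih i hi).1, inner_smul_right,
        (horth i hi).2, mul_zero, mul_zero]

end PrincipalVectors

/-! ### Principal angles between a subspace and a graph over it -/

section Graph

variable {n p : ℕ} {E F : Type*} [NormedAddCommGroup E] [InnerProductSpace ℂ E]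
  [FiniteDimensional ℂ E] [NormedAddCommGroup F] [InnerProductSpace ℂ F] [FiniteDimensional ℂ F]
  {f g : E →ₗ[ℂ] EuclideanSpace ℂ (Fin n)} {T : E →ₗ[ℂ] F}

omit [FiniteDimensional ℂ E] [FiniteDimensional ℂ F] in
theorem finrank_range_of_inner_eq_add (hg : ∀ a b, (inner ℂ (g a) (g b) : ℂ) =
    inner ℂ a b + inner ℂ (T a) (T b)) :
    Module.finrank ℂ (LinearMap.range g) = Module.finrank ℂ E := by
  apply LinearMap.finrank_range_of_inj
  rw [injective_iff_map_eq_zero]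
  intro a ha
  have h := congrArg Complex.re (hg a a)
  rw [ha, inner_zero_left, inner_self_eq_norm_sq_to_K, inner_self_eq_norm_sq_to_K] at h
  norm_cast at h
  simp only [Complex.coe_algebraMap] at h
  norm_cast at h
  rw [← norm_eq_zero]
  nlinarith [sq_nonneg ‖a‖, sq_nonneg ‖T a‖]

/-- Principal angles between the range of an isometry `f` and the range of a map `g` that has the
same `f`-component as `f` and whose remaining component has the Gram form of `T`: their tangents
are the singular values of `T`. -/
theorem IsPrincipalAngles.tan_eq_singularValues (hp : Module.finrank ℂ E = p)
    (hf : ∀ a b, (inner ℂ (f a) (f b) : ℂ) = inner ℂ a b)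
    (hfg : ∀ a b, (inner ℂ (f a) (g b) : ℂ) = inner ℂ a b)
    (hg : ∀ a b, (inner ℂ (g a) (g b) : ℂ) = inner ℂ a b + inner ℂ (T a) (T b))
    {θ : Fin p → ℝ} (hθ : IsPrincipalAngles (LinearMap.range f) (LinearMap.range g) θ) :
    (∀ k, θ k < Real.pi / 2) ∧ ∀ k, Real.tan (θ (Fin.rev k)) = T.singularValues k := by
  obtain ⟨-, u, v, huv⟩ := hθ
  have hproj := starProjection_principalVectors (fun k => (huv k).2.1)
    (fun k x y h => (huv k).2.2.1 ▸ (huv k).2.2.2 x y h)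
  have hua : ∀ k, ∃ a, f a = u k := fun k => (huv k).2.1.1
  have hvb : ∀ k, ∃ b, g b = v k := fun k => (huv k).2.1.2.1
  choose a ha using hua
  choose b hb using hvb
  have hcos : ∀ k, Real.cos (θ k) = ‖(inner ℂ (u k) (v k) : ℂ)‖ := fun k => (huv k).2.2.1
  have ha_on : Orthonormal ℂ a := by
    constructor
    · intro k
      have h1 : ‖u k‖ = 1 := (huv k).2.1.2.2.1
      have h2 := hf (a k) (a k)
      rw [ha, inner_self_eq_norm_sq_to_K, inner_self_eq_norm_sq_to_K, h1] at h2
      norm_cast at h2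
      have h3 : ‖a k‖ ^ 2 = 1 := by simpa using (by exact_mod_cast h2.symm : ‖a k‖ ^ 2 = 1 ^ 2)
      nlinarith [norm_nonneg (a k)]
    · intro i j hij
      have hlt : ∀ i j, i < j → (inner ℂ (a j) (a i) : ℂ) = 0 := fun i j h => by
        rw [← hf, ha, ha]; exact ((huv j).2.1.2.2.2.2 i h).1
      rcases lt_or_gt_of_ne hij with h | h
      · rw [← inner_conj_symm, hlt i j h, map_zero]
      · exact hlt j i h
  -- The relation P_K v = ⟨u, v⟩ u, tested against f x.
  have hbs : ∀ k, b k = (inner ℂ (u k) (v k) : ℂ) • a k := by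
    intro k
    refine ext_inner_left ℂ fun x => ?_
    rw [← hfg, hb]
    have hx : (LinearMap.range f).starProjection (f x) = f x :=
      Submodule.starProjection_eq_self_iff.2 ⟨x, rfl⟩
    rw [← hx, Submodule.inner_starProjection_left_eq_right, (hproj k).2, inner_smul_right, ← ha,
      hf, inner_smul_right]
  -- Weak form of a = cos²θ (1 + T*T) a, from P_L u = ⟨v, u⟩ v tested against g x.
  have hgram : ∀ k x, (inner ℂ x (a k) : ℂ) =
      (Real.cos (θ k) ^ 2 : ℝ) * (inner ℂ x (a k) + inner ℂ (T x) (T (a k))) := by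
    intro k x
    have hx : (LinearMap.range g).starProjection (g x) = g x :=
      Submodule.starProjection_eq_self_iff.2 ⟨x, rfl⟩
    have h1 : (inner ℂ x (a k) : ℂ) = inner ℂ (g x) (u k) := by
      rw [← ha, ← inner_conj_symm, ← hfg, inner_conj_symm]
    calc (inner ℂ x (a k) : ℂ) = inner ℂ (v k) (u k) * inner ℂ (g x) (v k) := by
          rw [h1, ← hx, Submodule.inner_starProjection_left_eq_right, (hproj k).1,
            inner_smul_right, hx]
      _ = inner ℂ (v k) (u k) * inner ℂ (u k) (v k) *
          (inner ℂ x (a k) + inner ℂ (T x) (T (a k))) := by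
          rw [← hb, hg, hb, hbs, map_smul, inner_smul_right, inner_smul_right, ← mul_add,
            ← mul_assoc]
      _ = _ := by
          rw [← inner_conj_symm, hcos, RCLike.conj_mul, Complex.ofReal_pow]
          rfl
  have hcos0 : ∀ k, Real.cos (θ k) ≠ 0 := by
    intro k h0
    have h := hgram k (a k)
    rw [h0, inner_self_eq_norm_sq_to_K, ha_on.1] at h
    simp at h
  have hlt : ∀ k, θ k < Real.pi / 2 := fun k =>
    lt_of_le_of_ne (huv k).1.2 fun h => hcos0 k (by rw [h, Real.cos_pi_div_two])
  refine ⟨hlt, ?_⟩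
  -- A pair admissible at a later step is admissible at every earlier one, so the maxima decrease.
  have hmono : Monotone θ := by
    intro j k hjk
    have hle : Real.cos (θ k) ≤ Real.cos (θ j) := by
      rw [hcos k]
      exact (huv j).2.2.2 _ _ ((huv k).2.1.mono hjk)
    by_contra! hlt'
    have := Real.cos_lt_cos_of_nonneg_of_le_pi_div_two (huv k).1.1 (huv j).1.2 hlt'
    linarith
  have htan0 : ∀ k, 0 ≤ Real.tan (θ k) := fun k =>
    Real.tan_nonneg_of_nonneg_of_le_pi_div_two (huv k).1.1 (huv k).1.2
  have hanti : Antitone fun k : Fin p => Real.tan (θ (Fin.rev k)) ^ 2 := by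
    intro j k hjk
    refine pow_le_pow_left₀ (htan0 _) ?_ 2
    refine Real.strictMonoOn_tan.monotoneOn ⟨?_, hlt _⟩ ⟨?_, hlt _⟩ (hmono (Fin.rev_le_rev.2 hjk))
    · linarith [(huv (Fin.rev k)).1.1, Real.pi_pos]
    · linarith [(huv (Fin.rev j)).1.1, Real.pi_pos]
  have heig : ∀ k, (LinearMap.adjoint T ∘ₗ T) (a k) = ((Real.tan (θ k) ^ 2 : ℝ) : ℂ) • a k := by
    intro k
    refine ext_inner_left ℂ fun x => ?_
    have h := hgram k x
    have hc : ((Real.cos (θ k) : ℝ) : ℂ) ≠ 0 := by exact_mod_cast hcos0 k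
    have ht : ((Real.tan (θ k) ^ 2 : ℝ) : ℂ) * (Real.cos (θ k) : ℝ) ^ 2 =
        1 - (Real.cos (θ k) : ℝ) ^ 2 := by
      rw [← Complex.ofReal_pow, ← Complex.ofReal_mul, ← mul_pow, Real.tan_mul_cos (hcos0 k),
        Real.sin_sq]
      push_cast; ring
    rw [LinearMap.comp_apply, LinearMap.adjoint_inner_right, inner_smul_right]
    rw [Complex.ofReal_pow] at h
    refine mul_right_cancel₀ (pow_ne_zero 2 hc) ?_
    linear_combination (-1 : ℂ) * h - ht * inner ℂ x (a k)
  let B : Module.Basis (Fin p) ℂ E := basisOfLinearIndependentOfCardEqFinrank' a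
    ha_on.linearIndependent (by rw [Fintype.card_fin, hp])
  have hB : ∀ k, B k = a k := fun k => by simp [B]
  have hev := T.isSymmetric_adjoint_comp_self.eigenvalues_eq_of_basis hp
    (B.reindex Fin.revPerm) hanti (fun i => by
      simp only [Module.Basis.reindex_apply, Fin.revPerm_symm, Fin.revPerm_apply, hB]
      exact heig _)
  intro k
  rw [T.singularValues_fin hp, hev, Real.sqrt_sq (htan0 _)]

/-- Both f and g keep the eigenvectors of T*T orthogonal, so their normalized images serve as
principal vectors, with angles arctan σ. -/
theorem exists_isPrincipalAngles (hp : Module.finrank ℂ E = p)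
    (hf : ∀ a b, (inner ℂ (f a) (f b) : ℂ) = inner ℂ a b)
    (hfg : ∀ a b, (inner ℂ (f a) (g b) : ℂ) = inner ℂ a b)
    (hg : ∀ a b, (inner ℂ (g a) (g b) : ℂ) = inner ℂ a b + inner ℂ (T a) (T b)) :
    ∃ θ : Fin p → ℝ, IsPrincipalAngles (LinearMap.range f) (LinearMap.range g) θ := by
  have hsym := T.isSymmetric_adjoint_comp_self
  -- Mathlib's eigenvalues decrease, whereas the first principal angle is the smallest.
  let e : Fin p → E := fun k => hsym.eigenvectorBasis hp (Fin.rev k)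
  let σ : Fin p → ℝ := fun k => T.singularValues (Fin.rev k : Fin p)
  -- This is (1 + σ²)^(-1/2), the factor that normalizes g (e k).
  let c : Fin p → ℝ := fun k => Real.cos (Real.arctan (σ k))
  have hσ0 : ∀ k, 0 ≤ σ k := fun k => T.singularValues_nonneg _
  have hσmono : Monotone σ := fun i j hij => T.singularValues_antitone (Fin.rev_le_rev.2 hij)
  have hc0 : ∀ k, 0 < c k := fun k => Real.cos_arctan_pos _
  have hc : ∀ k, c k ^ 2 * (1 + σ k ^ 2) = 1 := fun k => by
    rw [Real.cos_sq_arctan]; field_simp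
  have he1 : ∀ k, ‖e k‖ = 1 := fun k => (hsym.eigenvectorBasis hp).orthonormal.1 _
  have heo : ∀ i j, i ≠ j → (inner ℂ (e i) (e j) : ℂ) = 0 := fun i j hij =>
    (hsym.eigenvectorBasis hp).orthonormal.2 (fun h => hij (Fin.rev_injective h))
  have heT : ∀ x k, (inner ℂ (T x) (T (e k)) : ℂ) = ((σ k ^ 2 : ℝ) : ℂ) * inner ℂ x (e k) := by
    intro x k
    rw [← LinearMap.adjoint_inner_right, ← LinearMap.comp_apply]
    simp only [e, σ]
    rw [hsym.apply_eigenvectorBasis, inner_smul_right, T.sq_singularValues_fin hp]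
    rfl
  have hge : ∀ x k, (inner ℂ (g x) (g (e k)) : ℂ) = ((1 + σ k ^ 2 : ℝ) : ℂ) * inner ℂ x (e k) := by
    intro x k
    rw [hg, heT]; push_cast; ring
  have hfn : ∀ x, ‖f x‖ = ‖x‖ := by
    intro x
    have h := congrArg Complex.re (hf x x)
    rw [← sq_eq_sq₀ (norm_nonneg _) (norm_nonneg _)]
    simpa [inner_self_eq_norm_sq_to_K, ← Complex.ofReal_pow] using h
  have hgn : ∀ x, ‖g x‖ ^ 2 = ‖x‖ ^ 2 + ‖T x‖ ^ 2 := by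
    intro x
    have h := congrArg Complex.re (hg x x)
    simpa [inner_self_eq_norm_sq_to_K, ← Complex.ofReal_pow] using h
  have hgen : ∀ k, ‖g ((c k : ℂ) • e k)‖ = 1 := by
    intro k
    rw [map_smul, norm_smul, Complex.norm_real, Real.norm_of_nonneg (hc0 k).le]
    have h := congrArg Complex.re (hge (e k) k)
    rw [inner_self_eq_norm_sq_to_K, inner_self_eq_norm_sq_to_K, he1] at h
    have h' : ‖g (e k)‖ ^ 2 = 1 + σ k ^ 2 := by
      simpa [← Complex.ofReal_pow] using h
    have : (c k * ‖g (e k)‖) ^ 2 = 1 := by rw [mul_pow, h', hc]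
    exact (pow_eq_one_iff_of_nonneg (mul_nonneg (hc0 k).le (norm_nonneg _)) two_ne_zero).1 this
  have hfin : Module.finrank ℂ (LinearMap.range f) = p := by
    rw [finrank_range_of_inner_eq_add (T := (0 : E →ₗ[ℂ] E)) (fun a b => by simp [hf]), hp]
  -- the Rayleigh bound on the complement of the first eigenvectors
  have hRay : ∀ k y, (∀ i < k, (inner ℂ y (e i) : ℂ) = 0) → σ k ^ 2 * ‖y‖ ^ 2 ≤ ‖T y‖ ^ 2 := by
    intro k y hy
    let b := (hsym.eigenvectorBasis hp).reindex Fin.revPerm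
    have hbe : ∀ i, b i = e i := fun i => by simp [b, e]
    have hTy : (‖T y‖ ^ 2 : ℝ) = ∑ i, σ i ^ 2 * ‖(inner ℂ y (e i) : ℂ)‖ ^ 2 := by
      have h1 : (inner ℂ (T y) (T y) : ℂ) =
          ∑ i, ((σ i ^ 2 * ‖(inner ℂ y (e i) : ℂ)‖ ^ 2 : ℝ) : ℂ) := by
        rw [← LinearMap.adjoint_inner_left, ← b.sum_inner_mul_inner]
        refine Finset.sum_congr rfl fun i _ => ?_
        rw [LinearMap.adjoint_inner_left, hbe, heT, ← inner_conj_symm (e i) y, mul_assoc,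
          RCLike.mul_conj]
        push_cast
        rfl
      rw [inner_self_eq_norm_sq_to_K, ← Complex.ofReal_sum] at h1
      refine Complex.ofReal_injective (Eq.trans ?_ h1)
      rw [Complex.ofReal_pow]
      rfl
    rw [hTy, ← b.sum_sq_norm_inner_left, Finset.mul_sum]
    refine Finset.sum_le_sum fun i _ => ?_
    rw [hbe]
    rcases lt_or_ge i k with hi | hi
    · simp [hy i hi]
    · exact mul_le_mul_of_nonneg_right (pow_le_pow_left₀ (hσ0 k) (hσmono hi) 2) (sq_nonneg _)
  refine ⟨fun k => Real.arctan (σ k), ?_, fun k => f (e k), fun k => g ((c k : ℂ) • e k),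
    fun k => ⟨⟨Real.arctan_nonneg.2 (hσ0 k), (Real.arctan_lt_pi_div_two _).le⟩, ?_, ?_, ?_⟩⟩
  · rw [hfin, finrank_range_of_inner_eq_add hg, hp, min_self]
  · refine ⟨⟨_, rfl⟩, ⟨_, rfl⟩, by rw [hfn, he1], hgen k, fun i hi => ⟨?_, ?_⟩⟩
    · rw [hf, heo _ _ hi.ne']
    · simp only [map_smul]
      rw [inner_smul_left, inner_smul_right, hge, heo _ _ hi.ne']
      simp
  · rw [hfg, inner_smul_right, inner_self_eq_norm_sq_to_K, he1]
    rw [norm_mul, Complex.norm_real, Real.norm_of_nonneg (hc0 k).le]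
    simp [c]
  · rintro x y ⟨⟨a, rfl⟩, ⟨b, rfl⟩, hx1, hy1, horth⟩
    rw [hfg]
    rw [hfn] at hx1
    have hb : ∀ i < k, (inner ℂ b (e i) : ℂ) = 0 := by
      intro i hi
      have h := (horth i hi).2
      simp only [map_smul] at h
      rw [inner_smul_right, hge] at h
      have h1 : (c i : ℂ) ≠ 0 := by exact_mod_cast (hc0 i).ne'
      have h2 : ((1 + σ i ^ 2 : ℝ) : ℂ) ≠ 0 := by
        exact_mod_cast (by positivity : (1 + σ i ^ 2 : ℝ) ≠ 0)
      exact ((mul_eq_zero.1 h).resolve_left h1 |> mul_eq_zero.1).resolve_left h2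
    -- Here 1 = ‖b‖² + ‖T b‖² ≥ (1 + σ²)‖b‖², which bounds ‖b‖ by c k.
    have hb1 := hgn b
    rw [hy1] at hb1
    have hR := hRay k b hb
    have hbc : ‖b‖ ≤ c k := by
      rw [← sq_le_sq₀ (norm_nonneg _) (hc0 k).le]
      have h1 : ‖b‖ ^ 2 * (1 + σ k ^ 2) ≤ c k ^ 2 * (1 + σ k ^ 2) := by rw [hc]; linarith
      exact le_of_mul_le_mul_right h1 (by positivity)
    calc ‖(inner ℂ a b : ℂ)‖ ≤ ‖a‖ * ‖b‖ := norm_inner_le_norm _ _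
      _ ≤ c k := by rw [hx1, one_mul]; exact hbc

end Graph

/-! ### Translation between matrices and linear maps -/

section MatrixForm

theorem inner_toEuclideanLin_toEuclideanLin {n p q : ℕ} (A : Matrix (Fin n) (Fin p) ℂ)
    (B : Matrix (Fin n) (Fin q) ℂ) (x : EuclideanSpace ℂ (Fin p)) (y : EuclideanSpace ℂ (Fin q)) :
    (inner ℂ (A.toEuclideanLin x) (B.toEuclideanLin y) : ℂ) =
      inner ℂ x ((Aᴴ * B).toEuclideanLin y) := by
  rw [← LinearMap.adjoint_inner_right, ← Matrix.toEuclideanLin_conjTranspose_eq_adjoint]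
  simp [Matrix.toLpLin_apply, Matrix.mulVec_mulVec]

theorem toEuclideanLin_mul {n p q : ℕ} (A : Matrix (Fin n) (Fin p) ℂ)
    (B : Matrix (Fin p) (Fin q) ℂ) :
    (A * B).toEuclideanLin = A.toEuclideanLin ∘ₗ B.toEuclideanLin := by
  ext x
  simp [Matrix.toLpLin_apply]

theorem toEuclideanLin_one_apply {p : ℕ} (x : EuclideanSpace ℂ (Fin p)) :
    (1 : Matrix (Fin p) (Fin p) ℂ).toEuclideanLin x = x := by
  simp

/-- The projection onto the range of a matrix with orthonormal columns. -/
theorem orthProjMatrix_colRange {n p : ℕ} {A : Matrix (Fin n) (Fin p) ℂ} (hA : Aᴴ * A = 1) :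
    orthProjMatrix (colRange A) = A * Aᴴ := by
  rw [orthProjMatrix, LinearEquiv.symm_apply_eq]
  refine LinearMap.ext fun x => ?_
  refine Submodule.eq_starProjection_of_mem_of_inner_eq_zero ?_ ?_
  · rw [toEuclideanLin_mul]
    exact ⟨_, rfl⟩
  · rintro _ ⟨y, rfl⟩
    rw [inner_sub_left, inner_toEuclideanLin_toEuclideanLin, Matrix.conjTranspose_mul,
      Matrix.conjTranspose_conjTranspose, Matrix.mul_assoc, hA, Matrix.mul_one]
    nth_rw 1 [← toEuclideanLin_one_apply x]
    rw [inner_toEuclideanLin_toEuclideanLin, Matrix.conjTranspose_one, Matrix.one_mul, sub_self]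

theorem colRange_mul_of_isUnit {n p : ℕ} (A : Matrix (Fin n) (Fin p) ℂ)
    {B : Matrix (Fin p) (Fin p) ℂ} (hB : IsUnit B) : colRange (A * B) = colRange A := by
  rw [colRange, toEuclideanLin_mul, LinearMap.range_comp_of_range_eq_top, colRange]
  rw [LinearMap.range_eq_top]
  intro y
  refine ⟨B⁻¹.toEuclideanLin y, ?_⟩
  rw [← LinearMap.comp_apply, ← toEuclideanLin_mul,
    Matrix.mul_nonsing_inv _ ((Matrix.isUnit_iff_isUnit_det B).1 hB), toEuclideanLin_one_apply]

theorem isUnit_of_rank_eq {p : ℕ} {A : Matrix (Fin p) (Fin p) ℂ} (h : A.rank = p) : IsUnit A := by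
  rw [← Matrix.mulVec_surjective_iff_isUnit]
  have : LinearMap.range A.mulVecLin = ⊤ := by
    apply Submodule.eq_top_of_finrank_eq
    rw [Module.finrank_fin_fun]
    exact h
  exact LinearMap.range_eq_top.1 this

end MatrixForm

theorem corollary3p4 {n p r : ℕ}
    (X : Matrix (Fin n) (Fin p) ℂ) (Xperp : Matrix (Fin n) (Fin r) ℂ)
    (Y : Matrix (Fin n) (Fin p) ℂ)
    -- `[X, Xperp]` is a unitary matrix
    (hU₁ : (Matrix.fromCols X Xperp)ᴴ * Matrix.fromCols X Xperp = 1)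
    (hU₂ : Matrix.fromCols X Xperp * (Matrix.fromCols X Xperp)ᴴ = 1)
    (hrank : Y.rank = (Xᴴ * Y).rank)
    (hfull : Y.rank = min n p) :
    IsUnit (Xᴴ * Y) ∧
    min n p = p ∧
    (∃ θ : Fin (min n p) → ℝ, IsPrincipalAngles (colRange X) (colRange Y) θ) ∧
    ∀ θ : Fin (min n p) → ℝ, IsPrincipalAngles (colRange X) (colRange Y) θ →
      (∀ k, θ k < Real.pi / 2) ∧
      -- the tangents in decreasing order are the singular values in decreasing order
      (fun k => Real.tan (θ (Fin.rev k))) =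
        singularVector (orthProjMatrix (colRange Xperp) * Y * (Xᴴ * Y)⁻¹) := by
  rw [Matrix.conjTranspose_fromCols_eq_fromRows_conjTranspose, Matrix.fromRows_mul_fromCols,
    ← Matrix.fromBlocks_one, Matrix.fromBlocks_inj] at hU₁
  obtain ⟨hXX, -, -, hPP⟩ := hU₁
  rw [Matrix.conjTranspose_fromCols_eq_fromRows_conjTranspose, Matrix.fromCols_mul_fromRows] at hU₂
  have hpn : p ≤ n := by
    have h1 : (Xᴴ * X).rank ≤ n := (Matrix.rank_mul_le_right _ _).trans (Matrix.rank_le_height _)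
    rwa [hXX, Matrix.rank_one, Fintype.card_fin] at h1
  have hmin : min n p = p := min_eq_right hpn
  have hunit : IsUnit (Xᴴ * Y) := isUnit_of_rank_eq (by rw [← hrank, hfull, hmin])
  have hdet : IsUnit (Xᴴ * Y).det := (Matrix.isUnit_iff_isUnit_det _).1 hunit
  set Z := Y * (Xᴴ * Y)⁻¹ with hZ
  have hXZ : Xᴴ * Z = 1 := by
    rw [hZ, ← Matrix.mul_assoc, Matrix.mul_nonsing_inv _ hdet]
  have hZX : Zᴴ * X = 1 := by
    simpa using congrArg Matrix.conjTranspose hXZ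
  have hYZ : colRange Y = colRange Z :=
    (colRange_mul_of_isUnit Y ((Matrix.isUnit_nonsing_inv_iff).2 hunit)).symm
  have hT : orthProjMatrix (colRange Xperp) * Y * (Xᴴ * Y)⁻¹ = Xperp * Xperpᴴ * Z := by
    rw [orthProjMatrix_colRange hPP, Matrix.mul_assoc]
  -- Pythagoras: the component of Z along R(X) is X itself, with Gram matrix 1.
  have hTT : (Xperp * Xperpᴴ * Z)ᴴ * (Xperp * Xperpᴴ * Z) = Zᴴ * Z - 1 := by
    have h1 : Xperp * Xperpᴴ = 1 - X * Xᴴ := eq_sub_of_add_eq' hU₂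
    calc (Xperp * Xperpᴴ * Z)ᴴ * (Xperp * Xperpᴴ * Z)
        = Zᴴ * (Xperp * (Xperpᴴ * Xperp) * Xperpᴴ) * Z := by
          simp only [Matrix.conjTranspose_mul, Matrix.conjTranspose_conjTranspose,
            Matrix.mul_assoc]
      _ = Zᴴ * Z - (Zᴴ * X) * (Xᴴ * Z) := by
          rw [hPP, Matrix.mul_one, h1]
          simp only [Matrix.mul_sub, Matrix.sub_mul, Matrix.mul_one, Matrix.mul_assoc]
      _ = Zᴴ * Z - 1 := by rw [hXZ, hZX, Matrix.mul_one]
  have hp : Module.finrank ℂ (EuclideanSpace ℂ (Fin p)) = p := finrank_euclideanSpace_fin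
  have hf : ∀ a b, (inner ℂ (X.toEuclideanLin a) (X.toEuclideanLin b) : ℂ) = inner ℂ a b :=
    fun a b => by rw [inner_toEuclideanLin_toEuclideanLin, hXX, toEuclideanLin_one_apply]
  have hfg : ∀ a b, (inner ℂ (X.toEuclideanLin a) (Z.toEuclideanLin b) : ℂ) = inner ℂ a b :=
    fun a b => by rw [inner_toEuclideanLin_toEuclideanLin, hXZ, toEuclideanLin_one_apply]
  have hg : ∀ a b, (inner ℂ (Z.toEuclideanLin a) (Z.toEuclideanLin b) : ℂ) = inner ℂ a b +
      inner ℂ ((Xperp * Xperpᴴ * Z).toEuclideanLin a) ((Xperp * Xperpᴴ * Z).toEuclideanLin b) :=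
    fun a b => by
      rw [inner_toEuclideanLin_toEuclideanLin, inner_toEuclideanLin_toEuclideanLin, hTT, map_sub,
        LinearMap.sub_apply, toEuclideanLin_one_apply, inner_sub_right, add_sub_cancel]
  refine ⟨hunit, hmin, ?_⟩
  rw [hYZ, hT]
  unfold singularVector
  rw [hmin]
  refine ⟨exists_isPrincipalAngles hp hf hfg hg, fun θ hθ => ?_⟩
  have h := hθ.tan_eq_singularValues hp hf hfg hg
  exact ⟨h.1, funext h.2⟩
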